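/- Let $r\ge 2$ and $\ell\ge 0$ be integers. For $n\ge 0$ let $\mathcal{B}_{r,r}(n)$ be the set of partitions $\lambda=(\lambda_1\ge\lambda_2\ge\cdots\ge\lambda_s\ge 1)$ of $n$ such that $\lambda_j-\lambda_{j+r-1}\ge 2$ for all $1\le j\le s-r+1$ and at most $r-1$ of the parts are equal to $1$ (for $n=0$ this set consists of the empty partition). Let $G_{r,\ell}(n)$ be the number of partitions in $\mathcal{B}_{r,r}(n)$ having at most $\ell$ parts different from $1$. Write $(q)_0=1$ and $(q)_k=(1-q)(1-q^2)\cdots(1-q^k)$ for $k\ge 1$. Then, as formal power series in $q$, $$\sum_{n\ge 0}G_{r,\ell}(n)\,q^n=\sum_{\substack{\partial_1\ge\cdots\ge\partial_{r-1}\ge 0\\ \partial_1+\cdots+\partial_{r-1}\le \ell+r-1}}\frac{q^{\partial_1^2+\cdots+\partial_{r-1}^2}}{(q)_{\partial_1-\partial_2}\cdots(q)_{\partial_{r-2}-\partial_{r-1}}(q)_{\partial_{r-1}}}-\sum_{\substack{\partial_1\ge\cdots\ge\partial_{r-1}\ge 0\\ \partial_1+\cdots+\partial_{r-1}=\ell+r}}\frac{q^{\partial_1^2+\cdots+\partial_{r-1}^2-(\ell+r)}\,(1-q^{\ell+r})}{(q)_{\partial_1-\partial_2}\cdots(q)_{\partial_{r-2}-\partial_{r-1}}(q)_{\partial_{r-1}}},$$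 where the sums run over integer sequences $(\partial_1,\dots,\partial_{r-1})$. -/

import Mathlib

open PowerSeries

/-- The parts of a partition `p`, listed in non-increasing order `λ₁ ≥ λ₂ ≥ ⋯`
(index `j` of the list, counted from `0`, is `λ_{j+1}`). -/
def sortedParts {n : ℕ} (p : n.Partition) : List ℕ :=
  p.parts.sort (fun a b => b ≤ a)

/-- The set `𝓑_{r,i}(n)` of partitions of `n` with `λ_j - λ_{j+r-1} ≥ 2` for all `j` for which
`λ_{j+r-1}` exists, and with at most `i - 1` parts equal to `1` (used for `1 ≤ i ≤ r`). -/
def gordonB (r i n : ℕ) : Set n.Partition :=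
  {p | (∀ (j : ℕ) (h : j + (r - 1) < (sortedParts p).length),
          (sortedParts p)[j + (r - 1)] + 2 ≤ (sortedParts p)[j]) ∧
        p.parts.count 1 ≤ i - 1}

/-- The set `𝓖_{r,ℓ}(n)` of the partitions in `𝓑_{r,r}(n)` with at most `ℓ` parts different
from `1`. -/
def gordonG (r l n : ℕ) : Set n.Partition :=
  {p | p ∈ gordonB r r n ∧ (p.parts.filter (· ≠ 1)).card ≤ l}

/-- The generating series `∑_{n ≥ 0} G_{r,ℓ}(n) q^n`, with `G_{r,ℓ}(n)` the cardinality of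
`𝓖_{r,ℓ}(n)`. -/
noncomputable def gordonGSeries (r l : ℕ) : ℚ⟦X⟧ :=
  PowerSeries.mk fun n => ((gordonG r l n).ncard : ℚ)

/-- `(q)_k = (1 - q)(1 - q²)⋯(1 - q^k)`, with `(q)_0 = 1`. -/
noncomputable def qFac (k : ℕ) : ℚ⟦X⟧ :=
  ∏ i ∈ Finset.range k, (1 - X ^ (i + 1))

/-- The finite set of sequences `∂_1 ≥ ⋯ ≥ ∂_{r-1} ≥ 0` of integers with sum `m`
(`∂_{j+1}` is the value at index `j`). -/
noncomputable def durfeeSeqs (r m : ℕ) : Finset (Fin (r - 1) → ℕ) :=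
  open Classical in
  (Finset.piAntidiag Finset.univ m).filter (fun d => Antitone d)

/-- The denominator `(q)_{∂_1-∂_2} ⋯ (q)_{∂_{r-2}-∂_{r-1}} (q)_{∂_{r-1}}`; the last factor is the
one for the convention `∂_r = 0`. -/
noncomputable def durfeeDenom (r : ℕ) (d : Fin (r - 1) → ℕ) : ℚ⟦X⟧ :=
  ∏ j : Fin (r - 1),
    qFac (d j - (if h : (j : ℕ) + 1 < r - 1 then d ⟨(j : ℕ) + 1, h⟩ else 0))

/-- The denominators have constant coefficient `1`, so that they are invertible power series. -/
theorem constantCoeff_durfeeDenom (r : ℕ) (d : Fin (r - 1) → ℕ) :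
    PowerSeries.constantCoeff (durfeeDenom r d) = 1 := by
  simp [durfeeDenom, qFac, map_prod]

/-- If `∂_1 + ⋯ + ∂_{r-1} = m` then `m ≤ ∂_1² + ⋯ + ∂_{r-1}²`: the subtraction of natural numbers
in the exponent `∂_1² + ⋯ + ∂_{r-1}² - m` does not truncate. -/
theorem le_sum_sq_of_mem_durfeeSeqs {r m : ℕ} {d : Fin (r - 1) → ℕ} (hd : d ∈ durfeeSeqs r m) :
    m ≤ ∑ j, d j ^ 2 := by
  simp only [durfeeSeqs, Finset.mem_filter, Finset.mem_piAntidiag] at hd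
  rw [← hd.1.1]
  exact Finset.sum_le_sum fun j _ => Nat.le_self_pow two_ne_zero (d j)

/-! Put K = r - 1. The difference condition says that any two consecutive integers occur at most K
times altogether. Let A_t[m] be the generating function in q of such partitions with m parts, at
most t of them equal to 1. Deleting exactly u ones and lowering every other part by one leaves a
partition with at most K - u ones, so A_t[m] = ∑_{u ≤ t} q^m A_{K-u}[m-u]. Together with A_K[0] = 1
this determines everything (`IsGordonFamily.unique`). The nested Durfee sums whose linear exponents
are t zeros followed by K - t ones obey the same recursion, by the contiguous relation
`durfeeSeries_zeros_ones`. Hence A_K[m] is the sum over the sequences ∂ of total m.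

Now let M = l + r. A partition counted by G has at most l + K < M parts. Among the partitions with m
< M parts, those to be discarded have more than l parts different from 1, that is, at most m - l - 1
ones. Their total is ∑_{u=1}^{K} A_{K-u}[M-u] (`IsGordonFamily.sum_range_eq`). These are the terms u
≥ 1 of Q = ∑_{u=0}^{K} A_{K-u}[M-u], while the recursion gives A_K[M] = q^M Q. The term u = 0 of Q
is A_K[M] itself, so the discarded total is (1 - q^M) Q = q^{-M} (1 - q^M) A_K[M], the subtracted
sum. -/

/-! ### Nested Durfee sums: the outer variable is x, and the inner one is q. -/

/-- One layer of a nested Durfee sum: `∑_{N ≤ L} x^N q^{N² + cN} w(L, N) f(N)`. -/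
noncomputable def durfeeLayer (w : ℕ → ℕ → ℚ⟦X⟧) (c : ℕ) (f : ℕ → ℚ⟦X⟧⟦X⟧) (L : ℕ) : ℚ⟦X⟧⟦X⟧ :=
  ∑ N ∈ Finset.range (L + 1), X ^ N * C (X ^ (N ^ 2 + c * N) * w L N) * f N

/-- The weight `1 / (q)_{L - N}`. -/
noncomputable def qFacWeight (L N : ℕ) : ℚ⟦X⟧ := (qFac (L - N))⁻¹

/-- The nested sum over `L ≥ N₁ ≥ N₂ ≥ ⋯` of
`x^{∑ N_j} q^{∑ N_j² + c_j N_j} w(L, N₁) / ((q)_{N₁ - N₂} (q)_{N₂ - N₃} ⋯)`. -/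
noncomputable def durfeeSum : (ℕ → ℕ → ℚ⟦X⟧) → List ℕ → ℕ → ℚ⟦X⟧⟦X⟧
  | w, [], L => C (w L 0)
  | w, c :: cs, L => durfeeLayer w c (durfeeSum qFacWeight cs) L

/-- The sum over all `N₁ ≥ N₂ ≥ ⋯ ≥ 0` of
`x^{∑ N_j} q^{∑ N_j² + c_j N_j} / ((q)_{N₁ - N₂} (q)_{N₂ - N₃} ⋯)`. -/
noncomputable def durfeeSeries (cs : List ℕ) : ℚ⟦X⟧⟦X⟧ :=
  PowerSeries.mk fun m => coeff m (durfeeSum (fun _ _ => 1) cs m)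

lemma constantCoeff_qFac (k : ℕ) : PowerSeries.constantCoeff (qFac k) = 1 := by
  simp [qFac, map_prod]

lemma qFac_mul_inv (k : ℕ) : qFac k * (qFac k)⁻¹ = 1 :=
  PowerSeries.mul_inv_cancel _ (by simp [constantCoeff_qFac])

lemma inv_qFac_succ (k : ℕ) :
    (qFac (k + 1))⁻¹ = X ^ (k + 1) * (qFac (k + 1))⁻¹ + (qFac k)⁻¹ := by
  have h : qFac (k + 1) = qFac k * (1 - X ^ (k + 1)) := by
    simp [qFac, Finset.prod_range_succ]
  have h1 := qFac_mul_inv k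
  have h2 := qFac_mul_inv (k + 1)
  rw [h] at h2 ⊢
  linear_combination (qFac k)⁻¹ * h2 -
    (1 - X ^ (k + 1)) * (qFac k * (1 - X ^ (k + 1)))⁻¹ * h1

lemma qFacWeight_succ_succ (L N : ℕ) : qFacWeight (L + 1) (N + 1) = qFacWeight L N := by
  simp [qFacWeight]

lemma durfeeLayer_zero (w : ℕ → ℕ → ℚ⟦X⟧) (c : ℕ) (f : ℕ → ℚ⟦X⟧⟦X⟧) :
    durfeeLayer w c f 0 = C (w 0 0) * f 0 := by
  simp [durfeeLayer]

/-- Propagates a relation through an outer layer. In the correction term N is replaced by N + 1, and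
(N+1)² + c(N+1) = N² + (c+2)N + (1+c). This is why every exponent to the left of an exchange rises
by 2. -/
lemma durfeeLayer_congr_shift {w : ℕ → ℕ → ℚ⟦X⟧} (hw : ∀ L N, w (L + 1) (N + 1) = w L N)
    (c j e : ℕ) {f f' g : ℕ → ℚ⟦X⟧⟦X⟧} (h0 : f 0 = f' 0)
    (h : ∀ N, f (N + 1) = f' (N + 1) + X ^ j * C (X ^ e) * g N) (L : ℕ) :
    durfeeLayer w c f (L + 1) = durfeeLayer w c f' (L + 1) +
      X ^ (j + 1) * C (X ^ (e + 1 + c)) * durfeeLayer w (c + 2) g L := by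
  simp only [durfeeLayer]
  rw [Finset.sum_range_succ' _ (L + 1), Finset.sum_range_succ' _ (L + 1), h0, add_right_comm,
    Finset.mul_sum, ← Finset.sum_add_distrib]
  congr 1
  refine Finset.sum_congr rfl fun N _ => ?_
  rw [h, hw]
  simp only [map_mul, map_pow]
  ring

/-- The factor q^(N+1) on f' raises the linear exponent of the layer by one; the g term is
re-indexed by N ↦ N + 1. -/
lemma durfeeLayer_shift {w : ℕ → ℕ → ℚ⟦X⟧} (hw : ∀ L N, w (L + 1) (N + 1) = w L N)
    (c : ℕ) {f f' g : ℕ → ℚ⟦X⟧⟦X⟧} (h0 : f 0 = f' 0)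
    (h : ∀ N, f (N + 1) = C (X ^ (N + 1)) * f' (N + 1) + g N) (L : ℕ) :
    durfeeLayer w c f (L + 1) = durfeeLayer w (c + 1) f' (L + 1) +
      X * C (X ^ (1 + c)) * durfeeLayer w (c + 2) g L := by
  simp only [durfeeLayer]
  rw [Finset.sum_range_succ' _ (L + 1), Finset.sum_range_succ' _ (L + 1), h0, add_right_comm,
    Finset.mul_sum, ← Finset.sum_add_distrib]
  congr 1
  · refine Finset.sum_congr rfl fun N _ => ?_
    rw [h, hw]
    simp only [map_mul, map_pow]
    ring

/-- Termwise this is 1/(q)_{d+1} = q^{d+1}/(q)_{d+1} + 1/(q)_d with d = M - N, since q^{(a+1)N}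
q^{M+1-N} = q^{aN} q^{M+1}. -/
lemma durfeeLayer_qFacWeight_succ (a : ℕ) (f : ℕ → ℚ⟦X⟧⟦X⟧) (M : ℕ) :
    durfeeLayer qFacWeight (a + 1) f (M + 1) =
      C (X ^ (M + 1)) * durfeeLayer qFacWeight a f (M + 1) +
        durfeeLayer qFacWeight (a + 1) f M := by
  simp only [durfeeLayer]
  rw [Finset.sum_range_succ, Finset.sum_range_succ _ (M + 1), mul_add (C _), Finset.mul_sum,
    add_right_comm, ← Finset.sum_add_distrib]
  congr 1
  · refine Finset.sum_congr rfl fun N hN => ?_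
    obtain ⟨d, rfl⟩ := Nat.exists_eq_add_of_le (Nat.lt_succ_iff.1 (Finset.mem_range.1 hN))
    have h1 : N + d + 1 - N = d + 1 := by omega
    have h2 : N + d - N = d := by omega
    have h3 := congrArg (C (R := ℚ⟦X⟧)) (inv_qFac_succ d)
    simp only [qFacWeight, h1, h2, map_mul, map_pow, map_add] at h3 ⊢
    linear_combination (X ^ N * C X ^ (N ^ 2 + (a + 1) * N) * f N) * h3
  · simp only [map_mul, map_pow]
    ring

/-- Interchanging two consecutive entries `a, a + 1` of the linear exponent. -/
lemma durfeeSum_swap {w : ℕ → ℕ → ℚ⟦X⟧} (hw : ∀ L N, w (L + 1) (N + 1) = w L N)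
    (P : List ℕ) (a : ℕ) (Q : List ℕ) :
    durfeeSum w (P ++ a :: (a + 1) :: Q) 0 = durfeeSum w (P ++ (a + 1) :: a :: Q) 0 ∧
    ∀ L, durfeeSum w (P ++ a :: (a + 1) :: Q) (L + 1) =
      durfeeSum w (P ++ (a + 1) :: a :: Q) (L + 1) +
      X ^ (P.length + 1) * C (X ^ (P.length + 1 + P.sum + a)) *
        durfeeSum w (P.map (· + 2) ++ (a + 2) :: (a + 1) :: Q) L := by
  induction P generalizing w with
  | nil =>
    refine ⟨by simp [durfeeSum, durfeeLayer_zero], fun L => ?_⟩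
    simpa [durfeeSum] using durfeeLayer_shift hw a (f := durfeeSum qFacWeight ((a + 1) :: Q))
      (f' := durfeeSum qFacWeight (a :: Q)) (by simp [durfeeSum, durfeeLayer_zero])
      (fun N => durfeeLayer_qFacWeight_succ a _ N) L
  | cons c P ih =>
    obtain ⟨ih0, ih1⟩ := ih qFacWeight_succ_succ
    refine ⟨by simp [durfeeSum, durfeeLayer_zero, ih0], fun L => ?_⟩
    have := durfeeLayer_congr_shift hw c _ _ ih0 ih1 L
    simp only [List.cons_append, durfeeSum, List.map_cons, List.length_cons, List.sum_cons]
    rw [this]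
    congr 5
    ring

/-- Raising the last entry of the linear exponent. -/
lemma durfeeSum_raise_last {w : ℕ → ℕ → ℚ⟦X⟧} (hw : ∀ L N, w (L + 1) (N + 1) = w L N)
    (P : List ℕ) (a : ℕ) :
    durfeeSum w (P ++ [a]) 0 = durfeeSum w (P ++ [a + 1]) 0 ∧
    ∀ L, durfeeSum w (P ++ [a]) (L + 1) = durfeeSum w (P ++ [a + 1]) (L + 1) +
      X ^ (P.length + 1) * C (X ^ (P.length + 1 + P.sum + a)) *
        durfeeSum w (P.map (· + 2) ++ [a + 2]) L := by
  induction P generalizing w with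
  | nil =>
    refine ⟨by simp [durfeeSum, durfeeLayer_zero], fun L => ?_⟩
    simpa [durfeeSum] using durfeeLayer_shift hw a (f := durfeeSum qFacWeight [])
      (f' := durfeeSum qFacWeight []) (g := durfeeSum qFacWeight []) rfl
      (fun N => by
        simp only [durfeeSum, qFacWeight, Nat.sub_zero, ← map_mul, ← map_add]
        rw [← inv_qFac_succ]) L
  | cons c P ih =>
    obtain ⟨ih0, ih1⟩ := ih qFacWeight_succ_succ
    refine ⟨by simp [durfeeSum, durfeeLayer_zero, ih0], fun L => ?_⟩
    have := durfeeLayer_congr_shift hw c _ _ ih0 ih1 L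
    simp only [List.cons_append, durfeeSum, List.map_cons, List.length_cons, List.sum_cons]
    rw [this]
    congr 5
    ring

/-! ### Passage to the unbounded sums -/

lemma coeff_durfeeLayer (w : ℕ → ℕ → ℚ⟦X⟧) (c : ℕ) (f : ℕ → ℚ⟦X⟧⟦X⟧) (L m : ℕ) :
    coeff m (durfeeLayer w c f L) = ∑ N ∈ Finset.range (L + 1),
      if N ≤ m then X ^ (N ^ 2 + c * N) * w L N * coeff (m - N) (f N) else 0 := by
  rw [durfeeLayer, map_sum]
  refine Finset.sum_congr rfl fun N _ => ?_
  rw [mul_assoc, coeff_X_pow_mul']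
  simp only [coeff_C_mul]

/-- Only N₁ ≤ m contributes to x^m, so the outer cutoff is immaterial once it reaches m. -/
lemma coeff_durfeeSum_one (cs : List ℕ) {m L : ℕ} (h : m ≤ L) :
    coeff m (durfeeSum (fun _ _ => 1) cs L) = coeff m (durfeeSeries cs) := by
  rw [durfeeSeries, coeff_mk]
  cases cs with
  | nil => simp [durfeeSum]
  | cons c cs =>
    simp only [durfeeSum, coeff_durfeeLayer]
    symm
    refine Finset.sum_subset (Finset.range_mono (by omega)) fun N _ hN => if_neg ?_
    simp only [Finset.mem_range] at hN
    omega

lemma durfeeSeries_eq_of_durfeeSum {cs cs' cs'' : List ℕ} {j e : ℕ}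
    (h : ∀ L, durfeeSum (fun _ _ => 1) cs (L + 1) = durfeeSum (fun _ _ => 1) cs' (L + 1) +
      X ^ j * C (X ^ e) * durfeeSum (fun _ _ => 1) cs'' L) :
    durfeeSeries cs = durfeeSeries cs' + X ^ j * C (X ^ e) * durfeeSeries cs'' := by
  ext1 m
  have := congrArg (coeff m) (h m)
  rw [map_add, mul_assoc, coeff_X_pow_mul', coeff_C_mul, coeff_durfeeSum_one _ (by omega),
    coeff_durfeeSum_one _ (by omega), coeff_durfeeSum_one _ (by omega)] at this
  rw [this, map_add, mul_assoc, coeff_X_pow_mul', coeff_C_mul]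

lemma durfeeSeries_swap (P : List ℕ) (a : ℕ) (Q : List ℕ) :
    durfeeSeries (P ++ a :: (a + 1) :: Q) = durfeeSeries (P ++ (a + 1) :: a :: Q) +
      X ^ (P.length + 1) * C (X ^ (P.length + 1 + P.sum + a)) *
        durfeeSeries (P.map (· + 2) ++ (a + 2) :: (a + 1) :: Q) :=
  durfeeSeries_eq_of_durfeeSum (durfeeSum_swap (fun _ _ => rfl) P a Q).2

lemma durfeeSeries_raise_last (P : List ℕ) (a : ℕ) :
    durfeeSeries (P ++ [a]) = durfeeSeries (P ++ [a + 1]) +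
      X ^ (P.length + 1) * C (X ^ (P.length + 1 + P.sum + a)) *
        durfeeSeries (P.map (· + 2) ++ [a + 2]) :=
  durfeeSeries_eq_of_durfeeSum (durfeeSum_raise_last (fun _ _ => rfl) P a).2

/-! ### Contiguous relations between the series -/

open List (replicate)

/-- Iterates `durfeeSeries_swap`, carrying the 2 leftwards across the block of ones; each exchange
leaves one correction term. -/
lemma durfeeSeries_move_left (P : List ℕ) (b : ℕ) (Q : List ℕ) :
    durfeeSeries (P ++ (replicate b 1 ++ 2 :: Q)) =
      durfeeSeries (P ++ 2 :: (replicate b 1 ++ Q)) +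
      ∑ s ∈ Finset.range b, X ^ (P.length + s + 1) * C (X ^ (P.length + P.sum + 2 * (s + 1))) *
        durfeeSeries (P.map (· + 2) ++ (replicate (s + 1) 3 ++
          2 :: (replicate (b - 1 - s) 1 ++ Q))) := by
  induction b generalizing P with
  | zero => simp
  | succ b ih =>
    have h1 := ih (P ++ [1])
    have h2 := durfeeSeries_swap P 1 (replicate b 1 ++ Q)
    simp only [List.append_assoc, List.singleton_append] at h1
    rw [List.replicate_succ, List.cons_append, h1, h2, Finset.sum_range_succ', List.cons_append]
    rw [add_assoc, add_comm (∑ s ∈ Finset.range b, _), ← add_assoc, ← add_assoc]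
    refine congrArg₂ _ (congrArg₂ _ rfl ?_) (Finset.sum_congr rfl fun s _ => ?_)
    · simp only [map_pow, List.replicate, List.cons_append, List.nil_append]
      congr 2
      ring
    · have e : b + 1 - 1 - (s + 1) = b - 1 - s := by omega
      rw [e]
      simp only [List.length_append, List.length_singleton, List.sum_append, List.sum_singleton,
        List.map_append, List.map_singleton, List.append_assoc,
        List.replicate_succ (n := s + 1), List.cons_append]
      congr 2
      · ring
      · congr 2; ring

lemma durfeeSeries_move_right (P : List ℕ) (v b : ℕ) (Q : List ℕ) :
    durfeeSeries (P ++ v :: (replicate b (v + 1) ++ Q)) =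
      durfeeSeries (P ++ (replicate b (v + 1) ++ v :: Q)) +
      ∑ u ∈ Finset.range b,
        X ^ (P.length + u + 1) * C (X ^ (P.length + 1 + P.sum + u * (v + 2) + v)) *
        durfeeSeries (P.map (· + 2) ++ (replicate u (v + 3) ++
          (v + 2) :: (replicate (b - u) (v + 1) ++ Q))) := by
  induction b generalizing P with
  | zero => simp
  | succ b ih =>
    have h1 := ih (P ++ [v + 1])
    have h2 := durfeeSeries_swap P v (replicate b (v + 1) ++ Q)
    simp only [List.append_assoc, List.singleton_append] at h1
    rw [List.replicate_succ, List.cons_append, h2, h1, Finset.sum_range_succ', List.cons_append]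
    rw [add_assoc]
    refine congrArg₂ _ rfl (congrArg₂ _ (Finset.sum_congr rfl fun s _ => ?_) ?_)
    · have e : b + 1 - (s + 1) = b - s := by omega
      rw [e]
      simp only [List.length_append, List.length_singleton, List.sum_append, List.sum_singleton,
        List.map_append, List.map_singleton, List.append_assoc,
        List.replicate_succ (n := s), List.cons_append]
      congr 2
      · ring
      · congr 2; ring
    · simp [List.replicate_succ]

lemma sum_range_sum_range_sub {M : Type*} [AddCommMonoid M] (b : ℕ) (F : ℕ → ℕ → M) :
    ∑ t ∈ Finset.range (b + 1), ∑ s ∈ Finset.range (b - t), F t s =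
      ∑ t ∈ Finset.range (b + 1), ∑ u ∈ Finset.range t, F u (t - u - 1) := by
  rw [Finset.sum_sigma', Finset.sum_sigma']
  refine Finset.sum_bij' (fun x _ => ⟨x.1 + x.2 + 1, x.1⟩) (fun x _ => ⟨x.2, x.1 - x.2 - 1⟩)
    ?_ ?_ ?_ ?_ ?_
  · rintro ⟨t, s⟩ h; simp at h ⊢; omega
  · rintro ⟨t, s⟩ h; simp at h ⊢; omega
  · rintro ⟨t, s⟩ h; simp at h ⊢; omega
  · rintro ⟨t, s⟩ h; simp at h ⊢; omega
  · rintro ⟨t, s⟩ h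
    have : t + s + 1 - t - 1 = s := by omega
    simp only [this]

/-- Both sides are compared with the series of 2^m 3^t 2 2 1^{b-t} Q: on the left the later 2 moves
left through the ones, on the right a 2 moves right through the threes. The two double sums of
corrections agree after re-indexing. -/
lemma durfeeSeries_ones_twos_step (m b : ℕ) (Q : List ℕ) :
    ∑ t ∈ Finset.range (b + 1), X ^ t * C (X ^ (2 * t)) *
      durfeeSeries (replicate m 2 ++ (replicate t 3 ++ 2 :: (replicate (b - t) 1 ++ 2 :: Q))) =
    ∑ t ∈ Finset.range (b + 1), X ^ t * C (X ^ (2 * t)) *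
      durfeeSeries (replicate (m + 1) 2 ++ (replicate t 3 ++ 2 :: (replicate (b - t) 1 ++ Q))) := by
  have h1 : ∀ t, durfeeSeries
      (replicate m 2 ++ (replicate t 3 ++ 2 :: (replicate (b - t) 1 ++ 2 :: Q))) =
      durfeeSeries (replicate m 2 ++ (replicate t 3 ++ 2 :: 2 :: (replicate (b - t) 1 ++ Q))) +
      ∑ s ∈ Finset.range (b - t),
        X ^ (m + t + s + 2) * C (X ^ (3 * m + 4 * t + 2 * s + 5)) *
        durfeeSeries (replicate m 4 ++ (replicate t 5 ++ 4 :: (replicate (s + 1) 3 ++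
          2 :: (replicate (b - (t + s + 1)) 1 ++ Q)))) := by
    intro t
    have := durfeeSeries_move_left (replicate m 2 ++ (replicate t 3 ++ [2])) (b - t) Q
    simp only [List.append_assoc, List.singleton_append] at this
    rw [this]
    refine congrArg₂ _ (by simp) (Finset.sum_congr rfl fun s _ => ?_)
    have e : b - t - 1 - s = b - (t + s + 1) := by omega
    rw [e]
    simp only [List.length_append, List.length_replicate, List.length_singleton, List.sum_append,
      List.sum_replicate, List.sum_singleton, List.map_append, List.map_replicate,
      List.map_singleton, List.append_assoc, List.singleton_append, smul_eq_mul]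
    congr 2
    · ring
    · congr 2; ring
  have h2 : ∀ t, durfeeSeries
      (replicate (m + 1) 2 ++ (replicate t 3 ++ 2 :: (replicate (b - t) 1 ++ Q))) =
      durfeeSeries (replicate m 2 ++ (replicate t 3 ++ 2 :: 2 :: (replicate (b - t) 1 ++ Q))) +
      ∑ u ∈ Finset.range t,
        X ^ (m + u + 1) * C (X ^ (3 * m + 4 * u + 3)) *
        durfeeSeries (replicate m 4 ++ (replicate u 5 ++ 4 :: (replicate (t - u) 3 ++
          2 :: (replicate (b - t) 1 ++ Q)))) := by
    intro t
    have := durfeeSeries_move_right (replicate m 2) 2 t (2 :: (replicate (b - t) 1 ++ Q))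
    rw [List.replicate_succ', List.append_assoc, List.singleton_append, this]
    refine congrArg₂ _ rfl (Finset.sum_congr rfl fun s _ => ?_)
    simp only [List.length_replicate, List.sum_replicate, List.map_replicate, smul_eq_mul]
    congr 2
    congr 2
    ring
  simp only [h1, h2, mul_add, Finset.sum_add_distrib]
  rw [add_right_inj]
  -- The correction (t, s) on the left matches the one on the right with outer index t + s + 1 and
  -- inner index t.
  simp only [Finset.mul_sum]
  rw [sum_range_sum_range_sub]
  refine Finset.sum_congr rfl fun t _ => Finset.sum_congr rfl fun u hu => ?_
  obtain ⟨d, rfl⟩ := Nat.exists_eq_add_of_lt (Finset.mem_range.1 hu)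
  have e2 : u + d + 1 - u = d + 1 := by omega
  simp only [e2, Nat.add_sub_cancel, map_pow]
  ring

/-- Collects into one series the corrections that arise in `durfeeSeries_zeros_ones`. By induction
on m, the extra 2 is first absorbed into Q and then transferred to the front. -/
lemma durfeeSeries_ones_twos (m b : ℕ) (Q : List ℕ) :
    durfeeSeries (replicate b 1 ++ (replicate (m + 1) 2 ++ Q)) =
      ∑ t ∈ Finset.range (b + 1), X ^ t * C (X ^ (2 * t)) *
        durfeeSeries (replicate m 2 ++ (replicate t 3 ++ 2 :: (replicate (b - t) 1 ++ Q))) := by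
  induction m generalizing Q with
  | zero =>
    have := durfeeSeries_move_left [] b Q
    simp only [List.nil_append] at this
    simp only [zero_add, List.replicate_one, List.singleton_append, List.replicate_zero,
      List.nil_append]
    rw [this, Finset.sum_range_succ', add_comm]
    refine congrArg₂ _ (Finset.sum_congr rfl fun s _ => ?_) (by simp)
    have e : b - 1 - s = b - (s + 1) := by omega
    simp [e]
  | succ m ih =>
    rw [← durfeeSeries_ones_twos_step, ← ih, List.replicate_succ', List.append_assoc,
      List.singleton_append]

/-- The contiguous relation between the series with linear exponents `0^{m+1} 1^b` and
`0^m 1^{b+1}`. -/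
lemma durfeeSeries_zeros_ones (m b : ℕ) :
    durfeeSeries (replicate (m + 1) 0 ++ replicate b 1) =
      durfeeSeries (replicate m 0 ++ replicate (b + 1) 1) +
      X ^ (m + 1) * C (X ^ (m + 1)) * durfeeSeries (replicate b 1 ++ replicate (m + 1) 2) := by
  have h1 := durfeeSeries_move_right (replicate m 0) 0 b []
  have h2 := durfeeSeries_raise_last (replicate m 0 ++ replicate b 1) 0
  have h3 := durfeeSeries_ones_twos m b []
  simp only [List.append_nil, List.append_assoc, zero_add] at h1 h2 h3
  -- The last 0 moves to the end past the ones and is then raised to 1. The moves give the terms t <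
  -- b of `durfeeSeries_ones_twos`, and the raising gives t = b.
  rw [List.replicate_succ', List.append_assoc, List.singleton_append, h1, h2, h3,
    Finset.sum_range_succ, mul_add, ← List.replicate_succ', add_assoc,
    add_comm _ (∑ u ∈ Finset.range b, _), Finset.mul_sum]
  refine congrArg₂ _ rfl (congrArg₂ _ (Finset.sum_congr rfl fun s _ => ?_) ?_)
  · simp only [List.length_replicate, List.sum_replicate, List.map_replicate, smul_eq_mul, map_pow]
    ring
  · simp only [List.length_append, List.sum_append, List.map_append, Nat.sub_self,
      List.replicate_zero, List.append_assoc,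
      List.length_replicate, List.sum_replicate, List.map_replicate, smul_eq_mul, map_pow]
    ring

/-! ### The substitution x ↦ xq -/

lemma rescale_C_eq {R : Type*} [CommSemiring R] (a b : R) : rescale a (C b) = C b := by
  ext n
  rw [coeff_rescale, coeff_C]
  split_ifs with h <;> simp [h]

/-- Raising all linear exponents by one multiplies each term by q^{∑ N_j}, and x records exactly ∑
N_j. -/
lemma durfeeSum_map_succ (w : ℕ → ℕ → ℚ⟦X⟧) (cs : List ℕ) (L : ℕ) :
    durfeeSum w (cs.map (· + 1)) L = rescale X (durfeeSum w cs L) := by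
  induction cs generalizing w L with
  | nil => simp [durfeeSum, rescale_C_eq]
  | cons c cs ih =>
    simp only [List.map_cons, durfeeSum, durfeeLayer, map_sum, map_mul, map_pow, rescale_X, ih,
      rescale_C_eq]
    refine Finset.sum_congr rfl fun N _ => ?_
    ring

lemma durfeeSeries_map_succ (cs : List ℕ) :
    durfeeSeries (cs.map (· + 1)) = rescale X (durfeeSeries cs) := by
  ext1 m
  simp [durfeeSeries, durfeeSum_map_succ]

lemma coeff_zero_durfeeSum (cs : List ℕ) :
    coeff 0 (durfeeSum qFacWeight cs 0) = 1 := by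
  induction cs with
  | nil => simp [durfeeSum, qFacWeight, qFac]
  | cons c cs ih =>
    rw [durfeeSum, durfeeLayer_zero, coeff_C_mul, ih]
    simp [qFacWeight, qFac]

lemma coeff_zero_durfeeSeries (cs : List ℕ) : coeff 0 (durfeeSeries cs) = 1 := by
  rw [durfeeSeries, coeff_mk]
  cases cs with
  | nil => simp [durfeeSum]
  | cons c cs =>
    rw [durfeeSum, durfeeLayer_zero, coeff_C_mul, coeff_zero_durfeeSum, mul_one]

/-! ### Gordon's recursion and its unique solution -/

/-- The recursion `A_t - A_{t-1} = (xq)^t A_{K-t}(xq)`, `A_0 = A_K(xq)`, satisfied by the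
generating functions in Gordon's theorem, in terms of the coefficients of `x^m`. -/
structure IsGordonFamily (K : ℕ) (A : ℕ → ℕ → ℚ⟦X⟧) : Prop where
  coeff_zero : A K 0 = 1
  zero_left (m : ℕ) : A 0 m = X ^ m * A K m
  succ_left (t m : ℕ) (ht : t < K) : A (t + 1) m =
    A t m + if t + 1 ≤ m then X ^ m * A (K - (t + 1)) (m - (t + 1)) else 0

lemma isGordonFamily_durfeeSeries (K : ℕ) :
    IsGordonFamily K fun t m => coeff m (durfeeSeries (replicate t 0 ++ replicate (K - t) 1)) where
  coeff_zero := coeff_zero_durfeeSeries _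
  zero_left m := by
    have := durfeeSeries_map_succ (replicate K 0)
    rw [List.map_replicate, zero_add] at this
    simp [this]
  succ_left t m ht := by
    obtain ⟨b, rfl⟩ := Nat.exists_eq_add_of_lt ht
    have e1 : t + b + 1 - (t + 1) = b := by omega
    have e2 : t + b + 1 - t = b + 1 := by omega
    have e3 : t + b + 1 - b = t + 1 := by omega
    have := durfeeSeries_map_succ (replicate b 0 ++ replicate (t + 1) 1)
    simp only [List.map_append, List.map_replicate, zero_add, Nat.reduceAdd] at this
    simp only [e1, e2, e3]
    rw [durfeeSeries_zeros_ones, this, map_add, mul_assoc, coeff_X_pow_mul']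
    split_ifs with h
    · rw [coeff_C_mul, coeff_rescale, ← mul_assoc, ← pow_add, Nat.add_sub_cancel' h]
    · rfl

namespace IsGordonFamily

variable {K : ℕ} {A B : ℕ → ℕ → ℚ⟦X⟧}

lemma eq_sum (hA : IsGordonFamily K A) {t : ℕ} (ht : t ≤ K) (m : ℕ) :
    A t m = ∑ u ∈ Finset.range (t + 1), if u ≤ m then X ^ m * A (K - u) (m - u) else 0 := by
  induction t with
  | zero => simpa using hA.zero_left m
  | succ t ih => rw [Finset.sum_range_succ, ← ih (by omega), hA.succ_left t m (by omega)]

lemma unique (hA : IsGordonFamily K A) (hB : IsGordonFamily K B) (m : ℕ) :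
    ∀ t ≤ K, A t m = B t m := by
  induction m using Nat.strong_induction_on with
  | _ m ih =>
    have key : A K m = B K m := by
      rcases Nat.eq_zero_or_pos m with rfl | hm
      · rw [hA.coeff_zero, hB.coeff_zero]
      have h1 := hA.eq_sum le_rfl m
      have h2 := hB.eq_sum le_rfl m
      rw [Finset.sum_range_succ'] at h1 h2
      have h3 : ∀ u ∈ Finset.range K,
          (if u + 1 ≤ m then X ^ m * A (K - (u + 1)) (m - (u + 1)) else 0) =
          (if u + 1 ≤ m then X ^ m * B (K - (u + 1)) (m - (u + 1)) else 0) := fun u _ => by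
        split_ifs with h
        · rw [ih _ (by omega) _ (by omega)]
        · rfl
      rw [Finset.sum_congr rfl h3] at h1
      simp only [Nat.zero_le, if_true, Nat.sub_zero] at h1 h2
      -- Only the term u = 0 of the recursion has index m, and it is q^m times the unknown. The
      -- other terms are known by induction, so 1 - q^m can be cancelled.
      have h4 : (1 - X ^ m : ℚ⟦X⟧) * A K m = (1 - X ^ m) * B K m := by
        linear_combination h1 - h2
      have h5 : (1 - X ^ m : ℚ⟦X⟧) ≠ 0 := fun h => by
        have := congrArg PowerSeries.constantCoeff h
        simp [hm.ne'] at this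
      exact mul_left_cancel₀ h5 h4
    intro t ht
    rw [hA.eq_sum ht, hB.eq_sum ht]
    refine Finset.sum_congr rfl fun u hu => ?_
    split_ifs with h
    · rcases Nat.eq_zero_or_pos u with rfl | hu0
      · simp [key]
      · rw [ih _ (by omega) _ (by omega)]
    · rfl

end IsGordonFamily

/-! ### Nested sums as sums over Durfee sequences -/

lemma durfeeDenom_cons (K L : ℕ) (e : Fin (K + 1) → ℕ) :
    durfeeDenom (K + 3) (Fin.cons L e) = qFac (L - e 0) * durfeeDenom (K + 2) e := by
  simp only [durfeeDenom]
  change ∏ j : Fin (K + 2), _ = _ * ∏ j : Fin (K + 1), _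
  rw [Fin.prod_univ_succ]
  refine congrArg₂ _ rfl (Finset.prod_congr rfl fun j _ => ?_)
  by_cases h : (j : ℕ) + 1 < K + 1
  · rw [dif_pos (by simpa using h), dif_pos (by simpa using h)]
    rfl
  · rw [dif_neg (by simpa using h), dif_neg (by simpa using h)]
    rfl

lemma antitone_cons_iff {K : ℕ} (L : ℕ) (e : Fin (K + 1) → ℕ) :
    Antitone (Fin.cons L e : Fin (K + 2) → ℕ) ↔ e 0 ≤ L ∧ Antitone e :=
  antitone_vecCons

open Classical in
-- Splits a monotone sequence into its first entry N, bounded by L, and a tail bounded by N.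
lemma sum_piAntidiag_antitone_succ {M : Type*} [AddCommMonoid M] (K L m : ℕ)
    (φ : (Fin (K + 1) → ℕ) → M) :
    (∑ N ∈ Finset.range (L + 1), if N ≤ m then
      ∑ d ∈ (Finset.piAntidiag Finset.univ (m - N)).filter
        (fun d : Fin K → ℕ => Antitone (Fin.cons N d : Fin (K + 1) → ℕ)), φ (Fin.cons N d)
      else 0) =
    ∑ e ∈ (Finset.piAntidiag Finset.univ m).filter
      (fun e : Fin (K + 1) → ℕ => e 0 ≤ L ∧ Antitone e), φ e := by
  rw [← Finset.sum_filter, Finset.sum_sigma']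
  refine Finset.sum_bij' (fun x _ => (Fin.cons x.1 x.2 : Fin (K + 1) → ℕ))
    (fun e _ => ⟨e 0, Fin.tail e⟩) ?_ ?_ ?_ ?_ ?_
  · rintro ⟨N, d⟩ h
    simp only [Finset.mem_sigma, Finset.mem_filter, Finset.mem_range, Finset.mem_piAntidiag,
      Fin.sum_univ_succ, Fin.cons_zero, Fin.cons_succ] at h ⊢
    obtain ⟨⟨h1, h2⟩, ⟨h3, -⟩, h4⟩ := h
    replace h3 : ∑ i, d i = m - N := h3
    exact ⟨⟨by omega, by simp⟩, by omega, h4⟩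
  · rintro e h
    simp only [Finset.mem_sigma, Finset.mem_filter, Finset.mem_range, Finset.mem_piAntidiag,
      Fin.sum_univ_succ, Fin.cons_self_tail] at h ⊢
    obtain ⟨⟨h1, -⟩, h3, h4⟩ := h
    refine ⟨⟨by omega, by omega⟩, ⟨?_, by simp⟩, h4⟩
    change ∑ i : Fin K, e i.succ = m - e 0
    omega
  · rintro ⟨N, d⟩ h; rfl
  · rintro e h; exact Fin.cons_self_tail e
  · rintro ⟨N, d⟩ h; rfl

open Classical in
-- The cutoff L is treated as an additional leading entry, so that both the bound on the first
-- summation index and the factor 1/(q)_{L-N₁} fit the pattern of the later entries.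
lemma coeff_durfeeSum_replicate_zero (K L m : ℕ) :
    coeff m (durfeeSum qFacWeight (replicate K 0) L) =
      ∑ d ∈ (Finset.piAntidiag Finset.univ m).filter
        (fun d : Fin K → ℕ => Antitone (Fin.cons L d : Fin (K + 1) → ℕ)),
        X ^ (∑ j, d j ^ 2) * (durfeeDenom (K + 2) (Fin.cons L d))⁻¹ := by
  induction K generalizing L m with
  | zero =>
    have h : ∀ d : Fin 0 → ℕ, Antitone (Fin.cons L d : Fin (0 + 1) → ℕ) := fun d =>
      haveI : Subsingleton (Fin (0 + 1)) := inferInstanceAs (Subsingleton (Fin 1))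
      Subsingleton.antitone _
    simp only [h, Finset.filter_true]
    rcases Nat.eq_zero_or_pos m with rfl | hm
    · have : durfeeDenom 2 ![L] = qFac L := by
        simp only [durfeeDenom]
        change ∏ j : Fin 1, _ = _
        simp
      simp [durfeeSum, qFacWeight, this]
    · simp [durfeeSum, coeff_C, hm.ne', Finset.piAntidiag_empty_of_ne_zero]
  | succ K ih =>
    rw [List.replicate_succ, durfeeSum, coeff_durfeeLayer]
    simp only [antitone_cons_iff]
    rw [← sum_piAntidiag_antitone_succ]
    refine Finset.sum_congr rfl fun N _ => ?_
    split_ifs with h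
    · rw [ih, Finset.mul_sum]
      refine Finset.sum_congr rfl fun d _ => ?_
      rw [durfeeDenom_cons, PowerSeries.mul_inv_rev, Fin.sum_univ_succ]
      simp only [qFacWeight, Fin.cons_zero, Fin.cons_succ]
      ring
    · rfl

lemma coeff_durfeeSeries_replicate_zero (K m : ℕ) :
    coeff m (durfeeSeries (replicate (K + 1) 0)) =
      ∑ d ∈ durfeeSeqs (K + 2) m, X ^ (∑ j, d j ^ 2) * (durfeeDenom (K + 2) d)⁻¹ := by
  classical
  have hS : durfeeSeqs (K + 2) m = (Finset.piAntidiag Finset.univ m).filter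
      (fun e : Fin (K + 1) → ℕ => e 0 ≤ m ∧ Antitone e) := by
    ext e
    simp only [durfeeSeqs, Finset.mem_filter, Finset.mem_piAntidiag]
    refine and_congr_right fun h => (and_iff_right ?_).symm
    rw [← h.1]
    exact Finset.single_le_sum (f := e) (fun _ _ => Nat.zero_le _)
      (Finset.mem_univ (0 : Fin (K + 1)))
  rw [hS, durfeeSeries, coeff_mk, List.replicate_succ, durfeeSum, coeff_durfeeLayer]
  refine Eq.trans ?_ (sum_piAntidiag_antitone_succ K m m
    fun d => X ^ (∑ j, d j ^ 2) * (durfeeDenom (K + 2) d)⁻¹)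
  refine Finset.sum_congr rfl fun N _ => ?_
  split_ifs with h
  · rw [coeff_durfeeSum_replicate_zero, Finset.mul_sum]
    refine Finset.sum_congr rfl fun d _ => ?_
    rw [Fin.sum_univ_succ]
    simp only [Fin.cons_zero, Fin.cons_succ]
    ring
  · rfl

/-! ### Gordon's recursion for partitions -/

/-- The multisets of `m` positive integers with sum `n` in which any two consecutive integers occur
at most `K` times altogether, and `1` occurs at most `t` times. -/
def gordonMultisets (K t m n : ℕ) : Set (Multiset ℕ) :=
  {s | 0 ∉ s ∧ (∀ k, s.count k + s.count (k + 1) ≤ K) ∧ s.count 1 ≤ t ∧ s.card = m ∧ s.sum = n}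

/-- The multisets of `gordonMultisets K t m n` in which `1` occurs exactly `t` times. -/
def gordonMultisetsExact (K t m n : ℕ) : Set (Multiset ℕ) :=
  {s | 0 ∉ s ∧ (∀ k, s.count k + s.count (k + 1) ≤ K) ∧ s.count 1 = t ∧ s.card = m ∧ s.sum = n}

lemma finite_setOf_multiset_sum_eq (n : ℕ) : {s : Multiset ℕ | 0 ∉ s ∧ s.sum = n}.Finite := by
  refine (Set.finite_range fun p : n.Partition => p.parts).subset ?_
  rintro s ⟨h0, hs⟩
  exact ⟨⟨s, fun {i} hi => Nat.pos_of_ne_zero fun h => h0 (h ▸ hi), hs⟩, rfl⟩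

lemma finite_gordonMultisets (K t m n : ℕ) : (gordonMultisets K t m n).Finite :=
  (finite_setOf_multiset_sum_eq n).subset fun _ h => ⟨h.1, h.2.2.2.2⟩

lemma finite_gordonMultisetsExact (K t m n : ℕ) : (gordonMultisetsExact K t m n).Finite :=
  (finite_setOf_multiset_sum_eq n).subset fun _ h => ⟨h.1, h.2.2.2.2⟩

/-- Raise all the elements of a multiset by one and add `t` ones. -/
def addOnes (t : ℕ) (s : Multiset ℕ) : Multiset ℕ := Multiset.replicate t 1 + s.map Nat.succ

lemma addOnes_injective (t : ℕ) : Function.Injective (addOnes t) := fun _ _ h =>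
  Multiset.map_injective Nat.succ_injective (add_left_cancel h)

lemma count_succ_map_succ (s : Multiset ℕ) (k : ℕ) :
    (s.map Nat.succ).count (k + 1) = s.count k :=
  Multiset.count_map_eq_count' _ _ Nat.succ_injective _

lemma card_addOnes (t : ℕ) (s : Multiset ℕ) : (addOnes t s).card = t + s.card := by
  simp [addOnes]

lemma sum_addOnes (t : ℕ) (s : Multiset ℕ) : (addOnes t s).sum = t + s.card + s.sum := by
  have : (s.map Nat.succ).sum = s.card + s.sum := by
    simp [Nat.succ_eq_add_one, Multiset.sum_map_add, add_comm]
  simp [addOnes, this, add_assoc]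

lemma count_one_addOnes (t : ℕ) (s : Multiset ℕ) : (addOnes t s).count 1 = t + s.count 0 := by
  rw [addOnes, Multiset.count_add, count_succ_map_succ, Multiset.count_replicate_self]

lemma count_add_two_addOnes (t : ℕ) (s : Multiset ℕ) (k : ℕ) :
    (addOnes t s).count (k + 2) = s.count (k + 1) := by
  rw [addOnes, Multiset.count_add, count_succ_map_succ, Multiset.count_replicate, if_neg (by omega),
    zero_add]

lemma zero_notMem_addOnes (t : ℕ) (s : Multiset ℕ) : 0 ∉ addOnes t s := by
  simp [addOnes, Multiset.mem_replicate]

lemma exists_addOnes_eq {s : Multiset ℕ} (h0 : 0 ∉ s) :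
    ∃ u, 0 ∉ u ∧ addOnes (s.count 1) u = s := by
  refine ⟨(s.filter (· ≠ 1)).map Nat.pred, ?_, ?_⟩
  · simp only [Multiset.mem_map, Multiset.mem_filter, not_exists, not_and, and_imp]
    intro a ha h1 h
    rcases a with _ | _ | a
    · exact h0 ha
    · exact h1 rfl
    · simp at h
  · have h1 : ((s.filter (· ≠ 1)).map Nat.pred).map Nat.succ = s.filter (· ≠ 1) := by
      rw [Multiset.map_map]
      refine (Multiset.map_congr rfl fun a ha => ?_).trans (Multiset.map_id _)
      have : a ≠ 0 := fun h => h0 (h ▸ (Multiset.mem_filter.1 ha).1)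
      exact Nat.succ_pred_eq_of_ne_zero this
    rw [addOnes, h1, ← Multiset.filter_eq']
    exact Multiset.filter_add_not _ _

/-- After lowering, the old twos become the ones; since ones and twos together number at most K, at
most K - t of them remain. Each of the t + p parts loses one unit, whence the shift of the sum. -/
lemma gordonMultisetsExact_eq_image {K t : ℕ} (ht : t ≤ K) (p n : ℕ) :
    gordonMultisetsExact K t (t + p) (t + p + n) = addOnes t '' gordonMultisets K (K - t) p n := by
  ext s
  constructor
  · rintro ⟨h0, hK, h1, hc, hs⟩
    obtain ⟨u, hu0, hu⟩ := exists_addOnes_eq h0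
    rw [h1] at hu
    subst hu
    rw [card_addOnes] at hc
    rw [sum_addOnes] at hs
    refine ⟨u, ⟨hu0, fun k => ?_, ?_, by omega, by omega⟩, rfl⟩
    · rcases k with _ | k
      · have := hK 1
        rw [h1, count_add_two_addOnes _ _ 0] at this
        rw [Multiset.count_eq_zero_of_notMem hu0]
        simp only [zero_add] at this ⊢
        omega
      · have := hK (k + 2)
        rwa [count_add_two_addOnes, count_add_two_addOnes _ _ (k + 1)] at this
    · have := hK 1
      rw [h1, count_add_two_addOnes _ _ 0] at this
      simp only [zero_add] at this
      omega
  · rintro ⟨u, ⟨hu0, hK, h1, hc, hs⟩, rfl⟩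
    have h2 : (addOnes t u).count 1 = t := by
      rw [count_one_addOnes, Multiset.count_eq_zero_of_notMem hu0, add_zero]
    refine ⟨zero_notMem_addOnes t u, fun k => ?_, h2, by rw [card_addOnes, hc],
      by rw [sum_addOnes, hc, hs]⟩
    rcases k with _ | _ | k
    · rw [Multiset.count_eq_zero_of_notMem (zero_notMem_addOnes t u), h2]
      omega
    · rw [h2, count_add_two_addOnes _ _ 0, zero_add]
      omega
    · rw [count_add_two_addOnes, count_add_two_addOnes _ _ (k + 1)]
      exact hK (k + 1)

lemma card_le_sum_of_zero_notMem {s : Multiset ℕ} (h0 : 0 ∉ s) : s.card ≤ s.sum := by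
  have := Multiset.card_nsmul_le_sum (s := s) (a := 1) fun x hx =>
    Nat.one_le_iff_ne_zero.2 fun h => h0 (h ▸ hx)
  simpa using this

/-- The generating function of `gordonMultisets K t m n` in the variable `n`. -/
noncomputable def gordonGF (K t m : ℕ) : ℚ⟦X⟧ :=
  PowerSeries.mk fun n => ((gordonMultisets K t m n).ncard : ℚ)

lemma ncard_gordonMultisetsExact {K t : ℕ} (ht : t ≤ K) (m n : ℕ) :
    ((gordonMultisetsExact K t m n).ncard : ℚ) =
      coeff n (if t ≤ m then X ^ m * gordonGF K (K - t) (m - t) else 0) := by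
  split_ifs with h
  · obtain ⟨p, rfl⟩ := Nat.exists_eq_add_of_le h
    rw [coeff_X_pow_mul', Nat.add_sub_cancel_left]
    split_ifs with hn
    · obtain ⟨n, rfl⟩ := Nat.exists_eq_add_of_le hn
      rw [gordonMultisetsExact_eq_image ht, Set.ncard_image_of_injective _ (addOnes_injective t),
        Nat.add_sub_cancel_left, gordonGF, coeff_mk]
    · have : gordonMultisetsExact K t (t + p) n = ∅ := by
        refine Set.eq_empty_of_forall_notMem fun s hs => hn ?_
        rw [← hs.2.2.2.1, ← hs.2.2.2.2]
        exact card_le_sum_of_zero_notMem hs.1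
      simp [this]
  · have : gordonMultisetsExact K t m n = ∅ := by
      refine Set.eq_empty_of_forall_notMem fun s hs => h ?_
      rw [← hs.2.2.2.1, ← hs.2.2.1]
      exact Multiset.count_le_card _ _
    simp [this]

lemma isGordonFamily_gordonGF (K : ℕ) : IsGordonFamily K (gordonGF K) where
  coeff_zero := by
    ext n
    rw [gordonGF, coeff_mk, coeff_one]
    split_ifs with hn
    · have : gordonMultisets K K 0 n = {0} := by
        ext s
        simp only [gordonMultisets, Multiset.card_eq_zero, Set.mem_ofPred_eq, Set.mem_singleton_iff]
        exact ⟨fun h => h.2.2.2.1, fun h => by simp [h, hn]⟩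
      simp [this]
    · have : gordonMultisets K K 0 n = ∅ := by
        refine Set.eq_empty_of_forall_notMem fun s hs => hn ?_
        rw [← hs.2.2.2.2, Multiset.card_eq_zero.1 hs.2.2.2.1, Multiset.sum_zero]
      simp [this]
  zero_left m := by
    ext n
    have h1 : gordonMultisets K 0 m n = gordonMultisetsExact K 0 m n := by
      simp [gordonMultisets, gordonMultisetsExact]
    have h2 := ncard_gordonMultisetsExact (Nat.zero_le K) m n
    rw [if_pos (Nat.zero_le m), Nat.sub_zero, Nat.sub_zero] at h2
    rw [← h2, gordonGF, coeff_mk, h1]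
  succ_left t m ht := by
    ext n
    have h1 : gordonMultisets K (t + 1) m n =
        gordonMultisets K t m n ∪ gordonMultisetsExact K (t + 1) m n := by
      ext s
      simp only [gordonMultisets, gordonMultisetsExact, Set.mem_union, Set.mem_ofPred_eq,
        Nat.le_succ_iff]
      tauto
    have h2 : Disjoint (gordonMultisets K t m n) (gordonMultisetsExact K (t + 1) m n) :=
      Set.disjoint_left.2 fun s hs hs' => by
        have h3 := hs.2.2.1
        have h4 := hs'.2.2.1
        omega
    rw [map_add, ← ncard_gordonMultisetsExact ht, gordonGF, gordonGF, coeff_mk, coeff_mk, h1,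
      Set.ncard_union_eq h2 (finite_gordonMultisets _ _ _ _) (finite_gordonMultisetsExact _ _ _ _),
      Nat.cast_add]

/-! ### From sorted lists to multiplicities, and the series of G -/

lemma gordon_list_condition_iff (K : ℕ) (l : List ℕ) (hl : l.Pairwise (fun a b => b ≤ a)) :
    (∀ (j : ℕ) (h : j + K < l.length), l[j + K] + 2 ≤ l[j]) ↔
      ∀ k, l.count k + l.count (k + 1) ≤ K := by
  have hmono : ∀ (i j : ℕ) (hj : j < l.length) (hij : i ≤ j), l[j] ≤ l[i] := by
    intro i j hj hij
    rcases hij.eq_or_lt with rfl | h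
    · exact le_rfl
    · exact List.pairwise_iff_getElem.1 hl i j _ _ h
  have hcount : ∀ (l : List ℕ) (k : ℕ), l.count k + l.count (k + 1) =
      (l.filter fun x => x = k ∨ x = k + 1).length := by
    intro l k
    induction l with
    | nil => simp
    | cons a l ih =>
      simp only [Bool.decide_or] at ih ⊢
      simp only [List.count_cons, List.filter_cons]
      by_cases h1 : a = k
      · subst h1; simp; omega
      · by_cases h2 : a = k + 1
        · subst h2; simp; omega
        · simp [h1, h2]; omega
  constructor
  · intro H k
    by_contra! hk
    rw [hcount] at hk
    obtain ⟨l', hsub, hk, hmem⟩ : ∃ l' : List ℕ, l'.Sublist l ∧ K < l'.length ∧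
        ∀ x ∈ l', x = k ∨ x = k + 1 :=
      ⟨_, List.filter_sublist, hk, fun x hx => by simpa using (List.mem_filter.1 hx).2⟩
    -- More than K entries lie in {k, k+1}. Their positions increase strictly, so the first and the
    -- one of index K are at least K apart, yet their values differ by at most 1.
    obtain ⟨f, hf⟩ := List.sublist_iff_exists_fin_orderEmbedding_get_eq.1 hsub
    have hgrow : ∀ i (hi : i < l'.length), (f ⟨0, by omega⟩ : ℕ) + i ≤ f ⟨i, hi⟩ := by
      intro i
      induction i with
      | zero => intro hi; simp
      | succ i ih =>
        intro hi
        have h1 := ih (by omega)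
        have h2 : f ⟨i, by omega⟩ < f ⟨i + 1, hi⟩ := f.strictMono (by simp [Fin.lt_def])
        rw [Fin.lt_def] at h2
        omega
    have h1 := hgrow K hk
    have h2 := (f ⟨K, hk⟩).2
    have h3 := H (f ⟨0, by omega⟩) (by omega)
    have h4 := hmono _ _ h2 h1
    have h5 := hf ⟨0, by omega⟩
    have h6 := hf ⟨K, hk⟩
    have h7 := hmem _ (List.get_mem l' ⟨0, by omega⟩)
    have h8 := hmem _ (List.get_mem l' ⟨K, hk⟩)
    rw [h5] at h7
    rw [h6] at h8
    simp only [List.get_eq_getElem] at h7 h8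
    omega
  · intro H j hj
    by_contra! hlt
    have h1 := H l[j + K]
    rw [hcount] at h1
    -- The K + 1 consecutive entries from position j to j + K all lie between l[j+K] and l[j+K] + 1.
    have h2 : ((l.drop j).take (K + 1)).length ≤ (l.filter fun x => x = l[j + K] ∨
        x = l[j + K] + 1).length := by
      refine List.Sublist.length_le ?_
      have h3 : ((l.drop j).take (K + 1)).filter (fun x => x = l[j + K] ∨ x = l[j + K] + 1) =
          (l.drop j).take (K + 1) := by
        rw [List.filter_eq_self]
        intro a ha
        obtain ⟨i, hi, rfl⟩ := List.mem_iff_getElem.1 ha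
        simp only [List.length_take, List.length_drop] at hi
        rw [List.getElem_take, List.getElem_drop]
        have h4 := hmono j (j + i) (by omega) (by omega)
        have h5 := hmono (j + i) (j + K) hj (by omega)
        simp only [decide_eq_true_eq]
        omega
      rw [← h3]
      exact List.Sublist.filter _ ((List.take_sublist _ _).trans (List.drop_sublist _ _))
    simp only [List.length_take, List.length_drop] at h2
    omega

lemma mem_gordonG_iff (K l n : ℕ) (p : n.Partition) :
    p ∈ gordonG (K + 1) l n ↔ (∀ k, p.parts.count k + p.parts.count (k + 1) ≤ K) ∧
      p.parts.count 1 ≤ K ∧ (p.parts.filter (· ≠ 1)).card ≤ l := by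
  have h := gordon_list_condition_iff K (sortedParts p) (Multiset.pairwise_sort _ _)
  have hc : ∀ k, (sortedParts p).count k = p.parts.count k := fun k => by
    rw [← Multiset.coe_count, sortedParts, Multiset.sort_eq]
  simp only [hc] at h
  simp only [gordonG, gordonB, Set.mem_ofPred_eq, Nat.add_sub_cancel, and_assoc]
  exact and_congr_left fun _ => h

/-- Sorts the partitions by the number t of ones and the number p of other parts; in each class the
ones are deleted and the rest lowered. -/
lemma gordonGSeries_eq_sum (K l : ℕ) :
    gordonGSeries (K + 1) l = ∑ t ∈ Finset.range (K + 1), ∑ p ∈ Finset.range (l + 1),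
      X ^ (t + p) * gordonGF K (K - t) p := by
  classical
  ext n
  set S : Set (Multiset ℕ) := (fun p : n.Partition => p.parts) '' gordonG (K + 1) l n with hS
  have hinj : Function.Injective fun p : n.Partition => p.parts := fun p q h =>
    Nat.Partition.ext h
  have hSmem : ∀ s, s ∈ S ↔ 0 ∉ s ∧ (∀ k, s.count k + s.count (k + 1) ≤ K) ∧
      s.count 1 ≤ K ∧ (s.filter (· ≠ 1)).card ≤ l ∧ s.sum = n := by
    intro s
    constructor
    · rintro ⟨p, hp, rfl⟩
      obtain ⟨h1, h2, h3⟩ := (mem_gordonG_iff _ _ _ _).1 hp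
      exact ⟨fun h => (p.parts_pos h).ne rfl, h1, h2, h3, p.parts_sum⟩
    · rintro ⟨h0, h1, h2, h3, h4⟩
      exact ⟨⟨s, fun {i} hi => Nat.pos_of_ne_zero fun h => h0 (h ▸ hi), h4⟩,
        (mem_gordonG_iff _ _ _ _).2 ⟨h1, h2, h3⟩, rfl⟩
  have hfin : S.Finite := (finite_setOf_multiset_sum_eq n).subset fun s hs =>
    ⟨((hSmem s).1 hs).1, ((hSmem s).1 hs).2.2.2.2⟩
  rw [gordonGSeries, coeff_mk, ← Set.ncard_image_of_injective _ hinj, ← hS,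
    Set.ncard_eq_toFinset_card S hfin, Finset.card_eq_sum_card_fiberwise
      (f := fun s => (s.count 1, (s.filter (· ≠ 1)).card))
      (t := Finset.range (K + 1) ×ˢ Finset.range (l + 1)), Nat.cast_sum, Finset.sum_product,
    map_sum]
  · refine Finset.sum_congr rfl fun t ht => ?_
    rw [map_sum]
    refine Finset.sum_congr rfl fun p hp => ?_
    rw [Finset.mem_range] at ht hp
    have h := ncard_gordonMultisetsExact (K := K) (t := t) (by omega) (t + p) n
    rw [if_pos (by omega), Nat.add_sub_cancel_left] at h
    rw [← h, ← Set.ncard_coe_finset]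
    congr 2
    ext s
    have hcard : s.count 1 + (s.filter (· ≠ 1)).card = s.card := by
      conv_rhs => rw [← Multiset.filter_add_not (· = 1) s, Multiset.card_add]
      rw [Multiset.filter_eq', Multiset.card_replicate]
    simp only [Finset.coe_filter, Set.Finite.mem_toFinset, hSmem, Prod.mk.injEq,
      Set.mem_ofPred_eq, gordonMultisetsExact]
    constructor
    · rintro ⟨⟨h0, h1, h2, h3, h4⟩, h5, h6⟩
      exact ⟨h0, h1, h5, by omega, h4⟩
    · rintro ⟨h0, h1, h2, h3, h4⟩
      exact ⟨⟨h0, h1, by omega, by omega, h4⟩, h2, by omega⟩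
  · intro s hs
    have := (hSmem s).1 (by simpa using hs)
    simp only [Finset.coe_product, Set.mem_prod, Finset.mem_coe, Finset.mem_range]
    omega

/-! ### Summation over the number of parts -/

namespace IsGordonFamily

variable {K : ℕ} {A : ℕ → ℕ → ℚ⟦X⟧}

lemma eq_X_pow_mul_sum (hA : IsGordonFamily K A) {M : ℕ} (hM : K ≤ M) :
    A K M = X ^ M * ∑ t ∈ Finset.range (K + 1), A (K - t) (M - t) := by
  rw [hA.eq_sum le_rfl, Finset.mul_sum]
  refine Finset.sum_congr rfl fun t ht => if_pos ?_
  rw [Finset.mem_range] at ht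
  omega

/-- Expanding by the number u of ones, the terms with m - u ≤ l form the first sum. For fixed m = l
+ K - t the remaining ones have u ≤ K - t - 1, and the recursion reassembles them into one member of
the family. -/
lemma sum_range_eq (hA : IsGordonFamily K A) (l : ℕ) :
    ∑ m ∈ Finset.range (l + (K + 1)), A K m =
      ∑ t ∈ Finset.range (K + 1), ∑ p ∈ Finset.range (l + 1), X ^ (t + p) * A (K - t) p +
      ∑ t ∈ Finset.range K, A (K - (t + 1)) (l + (K + 1) - (t + 1)) := by
  have h1 : ∑ m ∈ Finset.range (l + (K + 1)), A K m = ∑ u ∈ Finset.range (K + 1),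
      ∑ m ∈ Finset.range (l + (K + 1)), if u ≤ m then X ^ m * A (K - u) (m - u) else 0 := by
    rw [Finset.sum_comm]
    exact Finset.sum_congr rfl fun m _ => hA.eq_sum le_rfl m
  have h2 : ∀ u ∈ Finset.range (K + 1),
      (∑ m ∈ Finset.range (l + (K + 1)), if u ≤ m then X ^ m * A (K - u) (m - u) else 0) =
      ∑ p ∈ Finset.range (l + 1), X ^ (u + p) * A (K - u) p +
        ∑ s ∈ Finset.range (K - u), X ^ (u + (l + 1 + s)) * A (K - u) (l + 1 + s) := by
    intro u hu
    rw [Finset.mem_range] at hu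
    have e : l + (K + 1) = u + ((l + 1) + (K - u)) := by omega
    rw [e, Finset.sum_range_add, Finset.sum_eq_zero, zero_add, Finset.sum_range_add]
    · simp
    · intro m hm
      rw [Finset.mem_range] at hm
      exact if_neg (by omega)
  have h3 : ∀ t ∈ Finset.range K, A (K - (t + 1)) (l + (K + 1) - (t + 1)) =
      ∑ u ∈ Finset.range (K - t), X ^ (l + K - t) * A (K - u) (l + K - t - u) := by
    intro t ht
    rw [Finset.mem_range] at ht
    have e1 : K - (t + 1) + 1 = K - t := by omega
    have e2 : l + (K + 1) - (t + 1) = l + K - t := by omega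
    rw [hA.eq_sum (Nat.sub_le _ _), e1, e2]
    refine Finset.sum_congr rfl fun u hu => if_pos ?_
    rw [Finset.mem_range] at hu
    omega
  rw [h1, Finset.sum_congr rfl h2, Finset.sum_add_distrib, Finset.sum_congr rfl h3, add_right_inj,
    Finset.sum_sigma', Finset.sum_sigma']
  refine Finset.sum_bij' (fun x _ => ⟨K - x.1 - x.2 - 1, x.1⟩)
    (fun x _ => ⟨x.2, K - x.1 - x.2 - 1⟩) ?_ ?_ ?_ ?_ ?_
  · rintro ⟨u, s⟩ h; simp at h ⊢; omega
  · rintro ⟨u, s⟩ h; simp at h ⊢; omega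
  · rintro ⟨u, s⟩ h; simp at h ⊢; omega
  · rintro ⟨u, s⟩ h; simp at h ⊢; omega
  · rintro ⟨u, s⟩ h
    simp only [Finset.mem_sigma, Finset.mem_range] at h
    have e1 : l + K - (K - u - s - 1) = u + (l + 1 + s) := by omega
    simp only [e1, Nat.add_sub_cancel_left]

end IsGordonFamily

theorem proposition3p7 (r l : ℕ) (hr : 2 ≤ r) :
    gordonGSeries r l =
      (∑ m ∈ Finset.range (l + r), ∑ d ∈ durfeeSeqs r m,
        X ^ (∑ j, d j ^ 2) * (durfeeDenom r d)⁻¹) -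
      ∑ d ∈ durfeeSeqs r (l + r),
        X ^ ((∑ j, d j ^ 2) - (l + r)) * (1 - X ^ (l + r)) * (durfeeDenom r d)⁻¹ := by
  obtain ⟨k, rfl⟩ := Nat.exists_eq_add_of_le' hr
  have hA := isGordonFamily_gordonGF (k + 1)
  have hcoeff : ∀ m, ∑ d ∈ durfeeSeqs (k + 2) m,
      X ^ (∑ j, d j ^ 2) * (durfeeDenom (k + 2) d)⁻¹ = gordonGF (k + 1) (k + 1) m := fun m => by
    rw [← coeff_durfeeSeries_replicate_zero,
      hA.unique (isGordonFamily_durfeeSeries (k + 1)) m _ le_rfl, Nat.sub_self,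
      List.replicate_zero, List.append_nil]
  set M := l + (k + 2) with hM
  set Q := ∑ t ∈ Finset.range (k + 2), gordonGF (k + 1) (k + 1 - t) (M - t) with hQ
  have hAQ : gordonGF (k + 1) (k + 1) M = X ^ M * Q := hA.eq_X_pow_mul_sum (by omega)
  have hB : ∑ d ∈ durfeeSeqs (k + 2) M,
      X ^ ((∑ j, d j ^ 2) - M) * (1 - X ^ M) * (durfeeDenom (k + 2) d)⁻¹ = (1 - X ^ M) * Q := by
    -- Multiplying by q^M removes the subtraction in the exponent, which does not truncate because
    -- the sum of squares is at least M.
    refine mul_left_cancel₀ (pow_ne_zero M (X_ne_zero (R := ℚ))) ?_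
    rw [mul_left_comm, ← hAQ, ← hcoeff, Finset.mul_sum, Finset.mul_sum]
    refine Finset.sum_congr rfl fun d hd => ?_
    rw [← Nat.sub_add_cancel (le_sum_sq_of_mem_durfeeSeqs hd), Nat.add_sub_cancel, pow_add]
    ring
  have hQ' : Q = ∑ t ∈ Finset.range (k + 1), gordonGF (k + 1) (k + 1 - (t + 1)) (M - (t + 1)) +
      gordonGF (k + 1) (k + 1) M := Finset.sum_range_succ' _ (k + 1)
  rw [Finset.sum_congr rfl fun m _ => hcoeff m, hB, gordonGSeries_eq_sum, hA.sum_range_eq l,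
    sub_mul, one_mul, ← hAQ]
  linear_combination hQ'
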